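/- Let $d\ge 1$ and $\alpha\in\mathbb R$. For an open set $\Omega\subseteq\mathbb R^d$ let $\mathcal G(\Omega)=\mathcal E_M(\Omega)/\mathcal N(\Omega)$ be the special Colombeau algebra: $\mathcal E_M(\Omega)$ is the algebra of nets $(u_\varepsilon)_{\varepsilon\in(0,1]}$ of smooth functions $u_\varepsilon:\Omega\to\mathbb C$ such that for every compact $L\subset\Omega$ and every $\beta\in\mathbb N_0^d$ there is $N\ge 0$ with $\sup_{x\in L}|\partial^\beta u_\varepsilon(x)|=O(\varepsilon^{-N})$ as $\varepsilon\to0$, and $\mathcal N(\Omega)$ is the ideal of those nets for which $\sup_{x\in L}|\partial^\beta u_\varepsilon(x)|=O(\varepsilon^{m})$ for all compact $L\subset\Omega$, all $\beta$ and all $m\ge 0$. Composition with smooth maps and multiplication are defined componentwise on representatives. Let $\mathcal G_\tau(\mathbb R^d)=\mathcal E_{M,\tau}(\mathbb R^d)/\mathcal N_\tau(\mathbb R^d)$ be the algebra of tempered generalized functions: $\mathcal E_{M,\tau}(\mathbb R^d)$ consists of the nets of smooth functions such that for every $\beta$ there is $N\geq 0$ with $\sup_{x\in\mathbb R^d}(1+|x|)^{-N}|\partial^\beta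 u_\varepsilon(x)|=O(\varepsilon^{-N})$, and $\mathcal N_\tau(\mathbb R^d)$ of those such that for every $\beta$ there is $N\geq 0$ such that for all $p\geq 0$, $\sup_{x\in\mathbb R^d}(1+|x|)^{-N}|\partial^\beta u_\varepsilon(x)|=O(\varepsilon^{p})$. Let $K:\mathcal G_\tau(\mathbb R^d)\to\mathcal G(\mathbb R^d)$, $(u_\varepsilon)_\varepsilon+\mathcal N_\tau(\mathbb R^d)\mapsto(u_\varepsilon)_\varepsilon+\mathcal N(\mathbb R^d)$, be the canonical map. For $\Omega=\mathbb R^d$ or $\Omega=\mathbb R^d\setminus\{0\}$, $u\in\mathcal G(\Omega)$ is called homogeneous of degree $\alpha$ if for each real $\lambda>0$ the equality $u(\lambda x)=\lambda^\alpha u(x)$ holds in $\mathcal G(\Omega)$. 1. If $u\in\mathcal G(\mathbb R^d\setminus\{0\})$ is homogeneous of degree $\alpha$, then $u(x)=u\big(\tfrac{x}{|x|}\big)|x|^\alpha$ holds in $\mathcal G(\mathbb R^d\setminus\{0\})$. 2. If $u\in\mathcal G(\mathbb R^d)$ is homogeneous of degree $\alpha$, then there exists $v\in\mathcal G_\tau(\mathbb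 R^d)$ with $K(v)=u$. -/

import Mathlib

open Filter Topology TopologicalSpace
open scoped ContDiff

noncomputable section

namespace Colombeau

/-- Euclidean space `ℝ^d`, with the Euclidean norm. -/
abbrev Eu (d : ℕ) : Type := EuclideanSpace ℝ (Fin d)

/-- The index set `(0,1]` of the regularisation parameter `ε`. -/
abbrev Idx : Type := Set.Ioc (0 : ℝ) 1

/-- The filter `ε → 0` on `(0,1]`. -/
def toZero : Filter Idx := comap (fun ε : Idx => (ε : ℝ)) (𝓝 0)

/-- Nets `(u_ε)` of complex valued functions. In everything that follows only the values on an open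
set `Ω` matter; a smooth function on `Ω` is represented by any extension of it to `ℝ^d` by arbitrary
values, and the ideals of negligible nets identify all extensions of the same net. -/
abbrev Net (d : ℕ) : Type := Idx → Eu d → ℂ

/-- `‖D^n u_ε(x)‖ = O(ρ(ε, x))` as `ε → 0`, uniformly for `x ∈ S`. Here `D^n u_ε` is the `n`-th total
derivative in the open set `Ω`, whose norm is equivalent to the maximum of the
absolute values of the partial derivatives `∂^β u_ε`, `|β| = n`. -/
def HasBound {d : ℕ} (Ω : Opens (Eu d)) (S : Set (Eu d)) (n : ℕ) (ρ : Idx → Eu d → ℝ)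
    (u : Net d) : Prop :=
  ∃ C : ℝ, ∀ᶠ ε in toZero, ∀ x ∈ S,
    ‖iteratedFDerivWithin ℝ n (u ε) (Ω : Set (Eu d)) x‖ ≤ C * ρ ε x

/-- Each member of the net is `C^∞` on `Ω`. -/
def IsSmoothNet {d : ℕ} (Ω : Opens (Eu d)) (u : Net d) : Prop :=
  ∀ ε, ContDiffOn ℝ ∞ (u ε) (Ω : Set (Eu d))

/-- Moderate nets: on each compact subset of `Ω` every derivative is `O(ε^{-N})` for some `N`. -/
def IsModerate {d : ℕ} (Ω : Opens (Eu d)) (u : Net d) : Prop :=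
  IsSmoothNet Ω u ∧ ∀ S : Set (Eu d), IsCompact S → S ⊆ Ω → ∀ n : ℕ, ∃ N : ℕ,
    HasBound Ω S n (fun ε _ => ((ε : ℝ) ^ N)⁻¹) u

/-- Negligible nets: on each compact subset of `Ω` every derivative is `O(ε^m)` for all `m`. -/
def IsNegligible {d : ℕ} (Ω : Opens (Eu d)) (u : Net d) : Prop :=
  IsSmoothNet Ω u ∧ ∀ S : Set (Eu d), IsCompact S → S ⊆ Ω → ∀ n m : ℕ,
    HasBound Ω S n (fun ε _ => (ε : ℝ) ^ m) u

/-- Tempered moderate nets: each derivative is `O(ε^{-N} (1 + |x|)^N)` on `Ω` for some `N`. -/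
def IsTemperedModerate {d : ℕ} (Ω : Opens (Eu d)) (u : Net d) : Prop :=
  IsSmoothNet Ω u ∧ ∀ n : ℕ, ∃ N : ℕ,
    HasBound Ω Ω n (fun ε x => ((ε : ℝ) ^ N)⁻¹ * (1 + ‖x‖) ^ N) u

/-- Tempered negligible nets: for each derivative there is an `N` such that it is
`O(ε^p (1 + |x|)^N)` on `Ω` for all `p`. -/
def IsTemperedNegligible {d : ℕ} (Ω : Opens (Eu d)) (u : Net d) : Prop :=
  IsSmoothNet Ω u ∧ ∀ n : ℕ, ∃ N : ℕ, ∀ p : ℕ,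
    HasBound Ω Ω n (fun ε x => (ε : ℝ) ^ p * (1 + ‖x‖) ^ N) u

section Estimates

theorem idx_pow_le (ε : Idx) {N M : ℕ} (h : N ≤ M) : (ε : ℝ) ^ M ≤ (ε : ℝ) ^ N :=
  pow_le_pow_of_le_one ε.2.1.le ε.2.2 h

theorem idx_inv_pow_le (ε : Idx) {N M : ℕ} (h : N ≤ M) :
    ((ε : ℝ) ^ N)⁻¹ ≤ ((ε : ℝ) ^ M)⁻¹ :=
  inv_anti₀ (pow_pos ε.2.1 _) (idx_pow_le ε h)

theorem exists_uniform {P : ℕ → ℕ → Prop} (mono : ∀ i N M, N ≤ M → P i N → P i M)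
    (h : ∀ i, ∃ N, P i N) (n : ℕ) : ∃ N, ∀ i, i ≤ n → P i N := by
  choose f hf using h
  refine ⟨(Finset.range (n + 1)).sup f, fun i hi => mono i _ _ ?_ (hf i)⟩
  exact Finset.le_sup (f := f) (Finset.mem_range.2 (by omega))

variable {d : ℕ} {Ω : Opens (Eu d)} {S : Set (Eu d)} {n : ℕ} {ρ ρ' : Idx → Eu d → ℝ}
  {u v : Net d}

theorem HasBound.mono (h : HasBound Ω S n ρ u) (h0 : ∀ ε, ∀ x ∈ S, 0 ≤ ρ ε x)
    (hle : ∀ ε, ∀ x ∈ S, ρ ε x ≤ ρ' ε x) : HasBound Ω S n ρ' u := by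
  obtain ⟨C, hC⟩ := h
  refine ⟨|C|, hC.mono fun ε hε x hx => (hε x hx).trans ?_⟩
  calc C * ρ ε x ≤ |C| * ρ ε x := mul_le_mul_of_nonneg_right (le_abs_self C) (h0 ε x hx)
    _ ≤ |C| * ρ' ε x := mul_le_mul_of_nonneg_left (hle ε x hx) (abs_nonneg C)

theorem HasBound.add (hS : S ⊆ Ω) (hu : IsSmoothNet Ω u) (hv : IsSmoothNet Ω v)
    (h : HasBound Ω S n ρ u) (h' : HasBound Ω S n ρ v) : HasBound Ω S n ρ (u + v) := by
  obtain ⟨C, hC⟩ := h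
  obtain ⟨C', hC'⟩ := h'
  refine ⟨C + C', ?_⟩
  filter_upwards [hC, hC'] with ε h1 h2 x hx
  have hx' : x ∈ (Ω : Set (Eu d)) := hS hx
  rw [Pi.add_apply, iteratedFDerivWithin_add_apply
    (((hu ε) x hx').of_le (by exact_mod_cast le_top))
    (((hv ε) x hx').of_le (by exact_mod_cast le_top)) Ω.isOpen.uniqueDiffOn hx', add_mul]
  exact (norm_add_le _ _).trans (add_le_add (h1 x hx) (h2 x hx))

theorem HasBound.mul (hS : S ⊆ Ω) (hu : IsSmoothNet Ω u) (hv : IsSmoothNet Ω v)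
    (h0 : ∀ ε, ∀ x ∈ S, 0 ≤ ρ ε x)
    (h : ∀ i, i ≤ n → HasBound Ω S i ρ u) (h' : ∀ i, i ≤ n → HasBound Ω S i ρ' v) :
    HasBound Ω S n (fun ε x => ρ ε x * ρ' ε x) (u * v) := by
  have H : ∀ i, ∃ C : ℝ, i ≤ n → ∀ᶠ ε in toZero, ∀ x ∈ S,
      ‖iteratedFDerivWithin ℝ i (u ε) (Ω : Set (Eu d)) x‖ ≤ C * ρ ε x := by
    intro i
    by_cases hi : i ≤ n
    · obtain ⟨C, hC⟩ := h i hi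
      exact ⟨C, fun _ => hC⟩
    · exact ⟨0, fun hi' => absurd hi' hi⟩
  have H' : ∀ i, ∃ C : ℝ, i ≤ n → ∀ᶠ ε in toZero, ∀ x ∈ S,
      ‖iteratedFDerivWithin ℝ i (v ε) (Ω : Set (Eu d)) x‖ ≤ C * ρ' ε x := by
    intro i
    by_cases hi : i ≤ n
    · obtain ⟨C, hC⟩ := h' i hi
      exact ⟨C, fun _ => hC⟩
    · exact ⟨0, fun hi' => absurd hi' hi⟩
  choose C hC using H
  choose C' hC' using H'
  have A : ∀ᶠ ε in toZero, ∀ i ∈ Finset.range (n + 1), ∀ x ∈ S,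
      ‖iteratedFDerivWithin ℝ i (u ε) (Ω : Set (Eu d)) x‖ ≤ C i * ρ ε x :=
    (Filter.eventually_all_finset _).2 fun i hi =>
      hC i (by have := Finset.mem_range.1 hi; omega)
  have A' : ∀ᶠ ε in toZero, ∀ i ∈ Finset.range (n + 1), ∀ x ∈ S,
      ‖iteratedFDerivWithin ℝ i (v ε) (Ω : Set (Eu d)) x‖ ≤ C' i * ρ' ε x :=
    (Filter.eventually_all_finset _).2 fun i hi =>
      hC' i (by have := Finset.mem_range.1 hi; omega)
  refine ⟨∑ i ∈ Finset.range (n + 1), (n.choose i : ℝ) * |C i| * C' (n - i), ?_⟩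
  filter_upwards [A, A'] with ε h1 h2 x hx
  have hx' : x ∈ (Ω : Set (Eu d)) := hS hx
  refine (norm_iteratedFDerivWithin_mul_le (hu ε) (hv ε) Ω.isOpen.uniqueDiffOn hx'
    (n := n) (by exact_mod_cast le_top)).trans ?_
  rw [Finset.sum_mul]
  refine Finset.sum_le_sum fun i hi => ?_
  have hi' := Finset.mem_range.1 hi
  have e1 : ‖iteratedFDerivWithin ℝ i (u ε) (Ω : Set (Eu d)) x‖ ≤ |C i| * ρ ε x :=
    (h1 i hi x hx).trans (mul_le_mul_of_nonneg_right (le_abs_self _) (h0 ε x hx))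
  have e2 := h2 (n - i) (Finset.mem_range.2 (by omega)) x hx
  calc (n.choose i : ℝ) * ‖iteratedFDerivWithin ℝ i (u ε) (Ω : Set (Eu d)) x‖
        * ‖iteratedFDerivWithin ℝ (n - i) (v ε) (Ω : Set (Eu d)) x‖
      ≤ (n.choose i : ℝ) * (|C i| * ρ ε x) * (C' (n - i) * ρ' ε x) := by
        refine mul_le_mul (mul_le_mul_of_nonneg_left e1 (by positivity)) e2 (norm_nonneg _) ?_
        exact mul_nonneg (by positivity) (mul_nonneg (abs_nonneg _) (h0 ε x hx))
    _ = _ := by ring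

theorem hasBound_const (c : ℂ) (n : ℕ) : HasBound Ω S n (fun _ _ => 1) (fun _ _ => c) := by
  rcases Nat.eq_zero_or_pos n with rfl | hn
  · refine ⟨‖c‖, Eventually.of_forall fun ε x _ => ?_⟩
    simp
  · refine ⟨0, Eventually.of_forall fun ε x _ => ?_⟩
    rw [iteratedFDerivWithin_const_of_ne hn.ne']
    simp

theorem IsSmoothNet.add (hu : IsSmoothNet Ω u) (hv : IsSmoothNet Ω v) : IsSmoothNet Ω (u + v) :=
  fun ε => (hu ε).add (hv ε)

theorem IsSmoothNet.mul (hu : IsSmoothNet Ω u) (hv : IsSmoothNet Ω v) : IsSmoothNet Ω (u * v) :=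
  fun ε => (hu ε).mul (hv ε)

theorem isSmoothNet_const (c : ℂ) : IsSmoothNet Ω (fun _ _ => c) := fun _ => contDiffOn_const

theorem IsModerate.uniform (hu : IsModerate Ω u) (hS : IsCompact S) (hSΩ : S ⊆ Ω) (n : ℕ) :
    ∃ N : ℕ, ∀ i, i ≤ n → HasBound Ω S i (fun ε _ => ((ε : ℝ) ^ N)⁻¹) u :=
  exists_uniform (P := fun i N => HasBound Ω S i (fun ε _ => ((ε : ℝ) ^ N)⁻¹) u)
    (fun _ _ _ hNM h => h.mono (fun ε _ _ => inv_nonneg.2 (pow_nonneg ε.2.1.le _))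
      (fun ε _ _ => idx_inv_pow_le ε hNM)) (fun i => hu.2 S hS hSΩ i) n

theorem IsTemperedModerate.uniform (hu : IsTemperedModerate Ω u) (n : ℕ) :
    ∃ N : ℕ, ∀ i, i ≤ n → HasBound Ω Ω i (fun ε x => ((ε : ℝ) ^ N)⁻¹ * (1 + ‖x‖) ^ N) u := by
  refine exists_uniform
    (P := fun i N => HasBound Ω Ω i (fun ε x => ((ε : ℝ) ^ N)⁻¹ * (1 + ‖x‖) ^ N) u)
    (fun _ N M hNM h => h.mono (fun ε x _ => ?_) (fun ε x _ => ?_)) (fun i => hu.2 i) n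
  · have := ε.2.1
    positivity
  · have h1 := idx_inv_pow_le ε hNM
    have h2 : (1 + ‖x‖) ^ N ≤ (1 + ‖x‖) ^ M :=
      pow_le_pow_right₀ (by linarith [norm_nonneg x]) hNM
    have := ε.2.1
    exact mul_le_mul h1 h2 (by positivity) (by positivity)

theorem IsTemperedNegligible.uniform (hu : IsTemperedNegligible Ω u) (n : ℕ) :
    ∃ N : ℕ, ∀ i, i ≤ n → ∀ p : ℕ,
      HasBound Ω Ω i (fun ε x => (ε : ℝ) ^ p * (1 + ‖x‖) ^ N) u := by
  refine exists_uniform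
    (P := fun i N => ∀ p : ℕ, HasBound Ω Ω i (fun ε x => (ε : ℝ) ^ p * (1 + ‖x‖) ^ N) u)
    (fun _ N M hNM h p => (h p).mono (fun ε x _ => ?_) (fun ε x _ => ?_)) (fun i => hu.2 i) n
  · have := ε.2.1
    positivity
  · have := ε.2.1
    exact mul_le_mul_of_nonneg_left
      (pow_le_pow_right₀ (by linarith [norm_nonneg x]) hNM) (by positivity)

theorem isModerate_const (c : ℂ) : IsModerate Ω (fun _ _ => c) :=
  ⟨isSmoothNet_const c, fun _ _ _ n => ⟨0, by simpa using hasBound_const c n⟩⟩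

theorem IsModerate.add (hu : IsModerate Ω u) (hv : IsModerate Ω v) : IsModerate Ω (u + v) := by
  refine ⟨hu.1.add hv.1, fun S hS hSΩ n => ?_⟩
  obtain ⟨N, hN⟩ := hu.2 S hS hSΩ n
  obtain ⟨M, hM⟩ := hv.2 S hS hSΩ n
  refine ⟨N + M, HasBound.add hSΩ hu.1 hv.1 (hN.mono ?_ ?_) (hM.mono ?_ ?_)⟩
  · exact fun ε _ _ => inv_nonneg.2 (pow_nonneg ε.2.1.le _)
  · exact fun ε _ _ => idx_inv_pow_le ε (by omega)
  · exact fun ε _ _ => inv_nonneg.2 (pow_nonneg ε.2.1.le _)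
  · exact fun ε _ _ => idx_inv_pow_le ε (by omega)

theorem IsModerate.mul (hu : IsModerate Ω u) (hv : IsModerate Ω v) : IsModerate Ω (u * v) := by
  refine ⟨hu.1.mul hv.1, fun S hS hSΩ n => ?_⟩
  obtain ⟨N, hN⟩ := hu.uniform hS hSΩ n
  obtain ⟨M, hM⟩ := hv.uniform hS hSΩ n
  refine ⟨N + M, ?_⟩
  have := HasBound.mul hSΩ hu.1 hv.1
    (fun ε _ _ => inv_nonneg.2 (pow_nonneg ε.2.1.le _)) hN hM
  simpa only [pow_add, mul_inv] using this

theorem isTemperedModerate_const (c : ℂ) : IsTemperedModerate Ω (fun _ _ => c) :=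
  ⟨isSmoothNet_const c, fun n => ⟨0, by simpa using hasBound_const c n⟩⟩

theorem IsTemperedModerate.add (hu : IsTemperedModerate Ω u) (hv : IsTemperedModerate Ω v) :
    IsTemperedModerate Ω (u + v) := by
  refine ⟨hu.1.add hv.1, fun n => ?_⟩
  obtain ⟨N, hN⟩ := hu.2 n
  obtain ⟨M, hM⟩ := hv.2 n
  have key : ∀ (A B : ℕ), A ≤ B → ∀ (ε : Idx) (x : Eu d),
      ((ε : ℝ) ^ A)⁻¹ * (1 + ‖x‖) ^ A ≤ ((ε : ℝ) ^ B)⁻¹ * (1 + ‖x‖) ^ B := by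
    intro A B hAB ε x
    have h1 := idx_inv_pow_le ε hAB
    have h2 : (1 + ‖x‖) ^ A ≤ (1 + ‖x‖) ^ B :=
      pow_le_pow_right₀ (by linarith [norm_nonneg x]) hAB
    have := ε.2.1
    exact mul_le_mul h1 h2 (by positivity) (by positivity)
  have pos : ∀ (A : ℕ) (ε : Idx) (x : Eu d), 0 ≤ ((ε : ℝ) ^ A)⁻¹ * (1 + ‖x‖) ^ A := by
    intro A ε x
    have := ε.2.1
    positivity
  exact ⟨N + M, HasBound.add subset_rfl hu.1 hv.1
    (hN.mono (fun ε x _ => pos _ ε x) fun ε x _ => key _ _ (by omega) ε x)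
    (hM.mono (fun ε x _ => pos _ ε x) fun ε x _ => key _ _ (by omega) ε x)⟩

theorem IsTemperedModerate.mul (hu : IsTemperedModerate Ω u) (hv : IsTemperedModerate Ω v) :
    IsTemperedModerate Ω (u * v) := by
  refine ⟨hu.1.mul hv.1, fun n => ?_⟩
  obtain ⟨N, hN⟩ := hu.uniform n
  obtain ⟨M, hM⟩ := hv.uniform n
  refine ⟨N + M, ?_⟩
  refine (HasBound.mul subset_rfl hu.1 hv.1 (fun ε x _ => ?_) hN hM).mono
    (fun ε x _ => ?_) (fun ε x _ => le_of_eq ?_)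
  · have := ε.2.1
    positivity
  · have := ε.2.1
    positivity
  · simp only [pow_add, mul_inv]
    ring

theorem isNegligible_zero : IsNegligible Ω 0 :=
  ⟨isSmoothNet_const 0, fun _ _ _ n m => ⟨0, Eventually.of_forall fun ε x _ => by
    simp [Pi.zero_def]⟩⟩

theorem IsNegligible.add (hu : IsNegligible Ω u) (hv : IsNegligible Ω v) :
    IsNegligible Ω (u + v) :=
  ⟨hu.1.add hv.1, fun S hS hSΩ n m =>
    HasBound.add hSΩ hu.1 hv.1 (hu.2 S hS hSΩ n m) (hv.2 S hS hSΩ n m)⟩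

theorem IsModerate.mul_negligible (hu : IsModerate Ω u) (hv : IsNegligible Ω v) :
    IsNegligible Ω (u * v) := by
  refine ⟨hu.1.mul hv.1, fun S hS hSΩ n m => ?_⟩
  obtain ⟨N, hN⟩ := hu.uniform hS hSΩ n
  refine (HasBound.mul hSΩ hu.1 hv.1 (fun ε x _ => ?_) hN
    (fun i _ => hv.2 S hS hSΩ i (N + m))).mono (fun ε x _ => ?_) (fun ε x _ => le_of_eq ?_)
  · exact inv_nonneg.2 (pow_nonneg ε.2.1.le _)
  · have := ε.2.1
    positivity
  · have := ε.2.1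
    rw [pow_add, inv_mul_cancel_left₀ (by positivity)]

theorem isTemperedNegligible_zero : IsTemperedNegligible Ω 0 :=
  ⟨isSmoothNet_const 0, fun n => ⟨0, fun p => ⟨0, Eventually.of_forall fun ε x _ => by
    simp [Pi.zero_def]⟩⟩⟩

theorem IsTemperedNegligible.add (hu : IsTemperedNegligible Ω u)
    (hv : IsTemperedNegligible Ω v) : IsTemperedNegligible Ω (u + v) := by
  refine ⟨hu.1.add hv.1, fun n => ?_⟩
  obtain ⟨N, hN⟩ := hu.2 n
  obtain ⟨M, hM⟩ := hv.2 n
  have key : ∀ (A B p : ℕ), A ≤ B → ∀ (ε : Idx) (x : Eu d),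
      (ε : ℝ) ^ p * (1 + ‖x‖) ^ A ≤ (ε : ℝ) ^ p * (1 + ‖x‖) ^ B := by
    intro A B p hAB ε x
    have := ε.2.1
    exact mul_le_mul_of_nonneg_left
      (pow_le_pow_right₀ (by linarith [norm_nonneg x]) hAB) (by positivity)
  have pos : ∀ (A p : ℕ) (ε : Idx) (x : Eu d), 0 ≤ (ε : ℝ) ^ p * (1 + ‖x‖) ^ A := by
    intro A p ε x
    have := ε.2.1
    positivity
  exact ⟨N + M, fun p => HasBound.add subset_rfl hu.1 hv.1
    ((hN p).mono (fun ε x _ => pos _ _ ε x) fun ε x _ => key _ _ _ (by omega) ε x)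
    ((hM p).mono (fun ε x _ => pos _ _ ε x) fun ε x _ => key _ _ _ (by omega) ε x)⟩

theorem IsTemperedModerate.mul_negligible (hu : IsTemperedModerate Ω u)
    (hv : IsTemperedNegligible Ω v) : IsTemperedNegligible Ω (u * v) := by
  refine ⟨hu.1.mul hv.1, fun n => ?_⟩
  obtain ⟨N, hN⟩ := hu.uniform n
  obtain ⟨M, hM⟩ := hv.uniform n
  refine ⟨N + M, fun p => ?_⟩
  refine (HasBound.mul subset_rfl hu.1 hv.1 (fun ε x _ => ?_) hN
    (fun i hi => hM i hi (N + p))).mono (fun ε x _ => ?_) (fun ε x _ => le_of_eq ?_)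
  · have := ε.2.1
    positivity
  · have := ε.2.1
    positivity
  · have := ε.2.1
    have hne : (ε : ℝ) ^ N ≠ 0 := by positivity
    simp only [pow_add]
    field_simp

/-- On a compact set the factor `1 + |x|` is bounded. -/
theorem exists_one_add_norm_le (hS : IsCompact S) : ∃ R : ℝ, 0 ≤ R ∧ ∀ x ∈ S, 1 + ‖x‖ ≤ R := by
  obtain ⟨R, hR⟩ := hS.isBounded.exists_norm_le
  exact ⟨1 + |R|, by positivity, fun x hx => by linarith [hR x hx, le_abs_self R]⟩

theorem IsTemperedModerate.isModerate (hu : IsTemperedModerate Ω u) : IsModerate Ω u := by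
  refine ⟨hu.1, fun S hS hSΩ n => ?_⟩
  obtain ⟨N, C, hC⟩ := hu.2 n
  obtain ⟨R, hR0, hR⟩ := exists_one_add_norm_le hS
  refine ⟨N, |C| * R ^ N, hC.mono fun ε hε x hx => (hε x (hSΩ hx)).trans ?_⟩
  have := ε.2.1
  have h1 : (1 + ‖x‖) ^ N ≤ R ^ N := pow_le_pow_left₀ (by positivity) (hR x hx) N
  calc C * (((ε : ℝ) ^ N)⁻¹ * (1 + ‖x‖) ^ N)
      ≤ |C| * (((ε : ℝ) ^ N)⁻¹ * (1 + ‖x‖) ^ N) :=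
        mul_le_mul_of_nonneg_right (le_abs_self C) (by positivity)
    _ ≤ |C| * (((ε : ℝ) ^ N)⁻¹ * R ^ N) := by gcongr
    _ = |C| * R ^ N * ((ε : ℝ) ^ N)⁻¹ := by ring

theorem IsTemperedNegligible.isNegligible (hu : IsTemperedNegligible Ω u) :
    IsNegligible Ω u := by
  refine ⟨hu.1, fun S hS hSΩ n m => ?_⟩
  obtain ⟨N, hN⟩ := hu.2 n
  obtain ⟨C, hC⟩ := hN m
  obtain ⟨R, hR0, hR⟩ := exists_one_add_norm_le hS
  refine ⟨|C| * R ^ N, hC.mono fun ε hε x hx => (hε x (hSΩ hx)).trans ?_⟩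
  have := ε.2.1
  have h1 : (1 + ‖x‖) ^ N ≤ R ^ N := pow_le_pow_left₀ (by positivity) (hR x hx) N
  calc C * ((ε : ℝ) ^ m * (1 + ‖x‖) ^ N)
      ≤ |C| * ((ε : ℝ) ^ m * (1 + ‖x‖) ^ N) :=
        mul_le_mul_of_nonneg_right (le_abs_self C) (by positivity)
    _ ≤ |C| * ((ε : ℝ) ^ m * R ^ N) := by gcongr
    _ = |C| * R ^ N * (ε : ℝ) ^ m := by ring

variable {d' : ℕ} {Ω' : Opens (Eu d')}

/-- A bound for the derivatives of `u_ε ∘ φ` on a compact set. -/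
theorem HasBound.comp {φ : Eu d' → Eu d} (hφ : ContDiffOn ℝ ∞ φ (Ω' : Set (Eu d')))
    (hmaps : Set.MapsTo φ (Ω' : Set (Eu d')) (Ω : Set (Eu d))) (hu : IsSmoothNet Ω u)
    {T : Set (Eu d')} (hT : IsCompact T) (hTΩ : T ⊆ Ω') {r : Idx → ℝ} (hr : ∀ ε, 0 ≤ r ε)
    (h : ∀ i, i ≤ n → HasBound Ω (φ '' T) i (fun ε _ => r ε) u) :
    HasBound Ω' T n (fun ε _ => r ε) (fun ε => u ε ∘ φ) := by
  have H : ∀ i, ∃ C : ℝ, i ≤ n → ∀ᶠ ε in toZero, ∀ x ∈ φ '' T,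
      ‖iteratedFDerivWithin ℝ i (u ε) (Ω : Set (Eu d)) x‖ ≤ C * r ε := by
    intro i
    by_cases hi : i ≤ n
    · obtain ⟨C, hC⟩ := h i hi
      exact ⟨C, fun _ => hC⟩
    · exact ⟨0, fun hi' => absurd hi' hi⟩
  choose C hC using H
  have A : ∀ᶠ ε in toZero, ∀ i ∈ Finset.range (n + 1), ∀ x ∈ φ '' T,
      ‖iteratedFDerivWithin ℝ i (u ε) (Ω : Set (Eu d)) x‖ ≤ C i * r ε :=
    (Filter.eventually_all_finset _).2 fun i hi =>
      hC i (by have := Finset.mem_range.1 hi; omega)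
  have B : ∀ i : ℕ, ∃ D : ℝ, ∀ x ∈ T,
      ‖iteratedFDerivWithin ℝ i φ (Ω' : Set (Eu d')) x‖ ≤ D := fun i =>
    hT.exists_bound_of_continuousOn
      ((hφ.continuousOn_iteratedFDerivWithin (m := i) (by exact_mod_cast le_top)
        Ω'.isOpen.uniqueDiffOn).mono hTΩ)
  choose D hD using B
  set C₀ : ℝ := ∑ i ∈ Finset.range (n + 1), |C i| with hC₀
  set D₀ : ℝ := 1 + ∑ i ∈ Finset.range (n + 1), |D i| with hD₀
  have hD1 : 1 ≤ D₀ := by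
    have : 0 ≤ ∑ i ∈ Finset.range (n + 1), |D i| := Finset.sum_nonneg fun _ _ => abs_nonneg _
    linarith
  refine ⟨n.factorial * C₀ * D₀ ^ n, A.mono fun ε hε x hx => ?_⟩
  have := norm_iteratedFDerivWithin_comp_le (n := n) (C := C₀ * r ε) (D := D₀) (hu ε) hφ
    (by exact_mod_cast le_top) Ω.isOpen.uniqueDiffOn Ω'.isOpen.uniqueDiffOn hmaps (hTΩ hx)
    (fun i hi => ?_) (fun i hi1 hi => ?_)
  · refine this.trans (le_of_eq ?_)
    ring
  · have hi' : i ∈ Finset.range (n + 1) := Finset.mem_range.2 (by omega)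
    refine (hε i hi' _ (Set.mem_image_of_mem φ hx)).trans
      (mul_le_mul_of_nonneg_right ((le_abs_self _).trans ?_) (hr ε))
    exact Finset.single_le_sum (f := fun i => |C i|) (fun _ _ => abs_nonneg _) hi'
  · have hi' : i ∈ Finset.range (n + 1) := Finset.mem_range.2 (by omega)
    have h1 : |D i| ≤ ∑ i ∈ Finset.range (n + 1), |D i| :=
      Finset.single_le_sum (f := fun i => |D i|) (fun _ _ => abs_nonneg _) hi'
    calc ‖iteratedFDerivWithin ℝ i φ (Ω' : Set (Eu d')) x‖ ≤ D i := hD i x hx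
      _ ≤ D₀ := by linarith [le_abs_self (D i)]
      _ ≤ D₀ ^ i := le_self_pow₀ hD1 (by omega)

theorem IsSmoothNet.comp {φ : Eu d' → Eu d} (hu : IsSmoothNet Ω u)
    (hφ : ContDiffOn ℝ ∞ φ (Ω' : Set (Eu d')))
    (hmaps : Set.MapsTo φ (Ω' : Set (Eu d')) (Ω : Set (Eu d))) :
    IsSmoothNet Ω' (fun ε => u ε ∘ φ) := fun ε => (hu ε).comp hφ hmaps

theorem IsModerate.comp {φ : Eu d' → Eu d} (hu : IsModerate Ω u)
    (hφ : ContDiffOn ℝ ∞ φ (Ω' : Set (Eu d')))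
    (hmaps : Set.MapsTo φ (Ω' : Set (Eu d')) (Ω : Set (Eu d))) :
    IsModerate Ω' (fun ε => u ε ∘ φ) := by
  refine ⟨hu.1.comp hφ hmaps, fun T hT hTΩ n => ?_⟩
  have hc : IsCompact (φ '' T) := hT.image_of_continuousOn (hφ.continuousOn.mono hTΩ)
  have hs : φ '' T ⊆ Ω := (Set.image_mono hTΩ).trans hmaps.image_subset
  obtain ⟨N, hN⟩ := hu.uniform hc hs n
  exact ⟨N, HasBound.comp hφ hmaps hu.1 hT hTΩ
    (fun ε => inv_nonneg.2 (pow_nonneg ε.2.1.le _)) hN⟩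

theorem IsNegligible.comp {φ : Eu d' → Eu d} (hu : IsNegligible Ω u)
    (hφ : ContDiffOn ℝ ∞ φ (Ω' : Set (Eu d')))
    (hmaps : Set.MapsTo φ (Ω' : Set (Eu d')) (Ω : Set (Eu d))) :
    IsNegligible Ω' (fun ε => u ε ∘ φ) := by
  refine ⟨hu.1.comp hφ hmaps, fun T hT hTΩ n m => ?_⟩
  have hc : IsCompact (φ '' T) := hT.image_of_continuousOn (hφ.continuousOn.mono hTΩ)
  have hs : φ '' T ⊆ Ω := (Set.image_mono hTΩ).trans hmaps.image_subset
  exact HasBound.comp hφ hmaps hu.1 hT hTΩ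
    (fun ε => pow_nonneg ε.2.1.le _) (fun i _ => hu.2 _ hc hs i m)

theorem isModerate_of_contDiffOn {f : Eu d → ℂ} (hf : ContDiffOn ℝ ∞ f (Ω : Set (Eu d))) :
    IsModerate Ω (fun _ => f) := by
  refine ⟨fun _ => hf, fun S hS hSΩ n => ?_⟩
  obtain ⟨C, hC⟩ := hS.exists_bound_of_continuousOn
    ((hf.continuousOn_iteratedFDerivWithin (m := n) (by exact_mod_cast le_top)
        Ω.isOpen.uniqueDiffOn).mono hSΩ)
  exact ⟨0, C, Eventually.of_forall fun ε x hx => by simpa using hC x hx⟩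

end Estimates

/-- The algebra `ℰ_M(Ω)` of moderate nets. -/
def moderate {d : ℕ} (Ω : Opens (Eu d)) : Subalgebra ℂ (Net d) where
  carrier := {u | IsModerate Ω u}
  mul_mem' hu hv := IsModerate.mul hu hv
  add_mem' hu hv := IsModerate.add hu hv
  algebraMap_mem' c := isModerate_const c

/-- The ideal `𝒩(Ω)` of negligible nets in `ℰ_M(Ω)`. -/
def negligible {d : ℕ} (Ω : Opens (Eu d)) : Ideal (moderate Ω) where
  carrier := {u | IsNegligible Ω (u : Net d)}
  zero_mem' := isNegligible_zero
  add_mem' hu hv := IsNegligible.add hu hv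
  smul_mem' a _ hu := IsModerate.mul_negligible a.2 hu

/-- The special Colombeau algebra `𝒢(Ω) = ℰ_M(Ω) / 𝒩(Ω)`. -/
abbrev G {d : ℕ} (Ω : Opens (Eu d)) : Type := moderate Ω ⧸ negligible Ω

/-- The algebra `ℰ_{M,τ}(Ω)` of tempered moderate nets. -/
def temperedModerate {d : ℕ} (Ω : Opens (Eu d)) : Subalgebra ℂ (Net d) where
  carrier := {u | IsTemperedModerate Ω u}
  mul_mem' hu hv := IsTemperedModerate.mul hu hv
  add_mem' hu hv := IsTemperedModerate.add hu hv
  algebraMap_mem' c := isTemperedModerate_const c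

/-- The ideal `𝒩_τ(Ω)` of tempered negligible nets in `ℰ_{M,τ}(Ω)`. -/
def temperedNegligible {d : ℕ} (Ω : Opens (Eu d)) : Ideal (temperedModerate Ω) where
  carrier := {u | IsTemperedNegligible Ω (u : Net d)}
  zero_mem' := isTemperedNegligible_zero
  add_mem' hu hv := IsTemperedNegligible.add hu hv
  smul_mem' a _ hu := IsTemperedModerate.mul_negligible a.2 hu

/-- The algebra `𝒢_τ(Ω) = ℰ_{M,τ}(Ω) / 𝒩_τ(Ω)` of tempered generalized functions. -/
abbrev Gτ {d : ℕ} (Ω : Opens (Eu d)) : Type := temperedModerate Ω ⧸ temperedNegligible Ω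

/-- The canonical map `K : 𝒢_τ(Ω) → 𝒢(Ω)`, `[(u_ε)] ↦ [(u_ε)]`. -/
def K {d : ℕ} (Ω : Opens (Eu d)) : Gτ Ω →ₐ[ℂ] G Ω :=
  Ideal.quotientMapₐ (negligible Ω)
    (Subalgebra.inclusion (S := temperedModerate Ω) (T := moderate Ω)
      fun _ hu => IsTemperedModerate.isModerate hu)
    fun _ hu => IsTemperedNegligible.isNegligible hu

/-- Composition with a smooth map, on moderate nets. -/
def netComp {d d' : ℕ} {Ω : Opens (Eu d)} {Ω' : Opens (Eu d')} (φ : Eu d' → Eu d)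
    (hφ : ContDiffOn ℝ ∞ φ (Ω' : Set (Eu d')))
    (hmaps : Set.MapsTo φ (Ω' : Set (Eu d')) (Ω : Set (Eu d))) : moderate Ω →ₐ[ℂ] moderate Ω' where
  toFun u := ⟨fun ε => (u : Net d) ε ∘ φ, IsModerate.comp u.2 hφ hmaps⟩
  map_one' := rfl
  map_mul' _ _ := rfl
  map_zero' := rfl
  map_add' _ _ := rfl
  commutes' _ := rfl

/-- The composition `u ∘ φ ∈ 𝒢(Ω')`, that is `[(u_ε ∘ φ)]`, of `u = [(u_ε)] ∈ 𝒢(Ω)` with a smooth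
map `φ : Ω' → Ω`. -/
def G.comp {d d' : ℕ} {Ω : Opens (Eu d)} {Ω' : Opens (Eu d')} (u : G Ω) (φ : Eu d' → Eu d)
    (hφ : ContDiffOn ℝ ∞ φ (Ω' : Set (Eu d')))
    (hmaps : Set.MapsTo φ (Ω' : Set (Eu d')) (Ω : Set (Eu d))) : G Ω' :=
  Ideal.quotientMapₐ (negligible Ω') (netComp φ hφ hmaps)
    (fun w hu => IsNegligible.comp (u := (w : Net d)) hu hφ hmaps) u

/-- The element `[(f)_ε]` of `𝒢(Ω)` given by a smooth function `f` on `Ω`. -/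
def ofSmooth {d : ℕ} (Ω : Opens (Eu d)) (f : Eu d → ℂ)
    (hf : ContDiffOn ℝ ∞ f (Ω : Set (Eu d))) : G Ω :=
  Ideal.Quotient.mk (negligible Ω) ⟨fun _ => f, isModerate_of_contDiffOn hf⟩

/-- `ℝ^d ∖ {0}` as an open set. -/
def punctured (d : ℕ) : Opens (Eu d) := ⟨{0}ᶜ, isOpen_compl_singleton⟩

/-- `Ω` is a cone: `λ x ∈ Ω` for all `x ∈ Ω` and `λ > 0`. -/
def IsCone {d : ℕ} (Ω : Opens (Eu d)) : Prop :=
  ∀ c : ℝ, 0 < c → Set.MapsTo (fun x : Eu d => c • x) (Ω : Set (Eu d)) (Ω : Set (Eu d))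

theorem isCone_univ (d : ℕ) : IsCone (⊤ : Opens (Eu d)) := fun _ _ _ _ => trivial

theorem isCone_punctured (d : ℕ) : IsCone (punctured d) := fun _ hc _ hx =>
  smul_ne_zero hc.ne' hx

theorem contDiffOn_smul_const {d : ℕ} (Ω : Opens (Eu d)) (c : ℝ) :
    ContDiffOn ℝ ∞ (fun x : Eu d => c • x) (Ω : Set (Eu d)) :=
  (contDiff_id.const_smul c).contDiffOn

/-- `u ∈ 𝒢(Ω)` is homogeneous of degree `α`: for every real `c > 0` the equality
`u(c x) = c^α u(x)` holds in `𝒢(Ω)`. -/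
def G.IsHomogeneous {d : ℕ} {Ω : Opens (Eu d)} (hΩ : IsCone Ω) (u : G Ω) (α : ℝ) : Prop :=
  ∀ (c : ℝ) (hc : 0 < c),
    u.comp (fun x => c • x) (contDiffOn_smul_const Ω c) (hΩ c hc) = ((c ^ α : ℝ) : ℂ) • u

theorem contDiffOn_normalize (d : ℕ) :
    ContDiffOn ℝ ∞ (fun x : Eu d => ‖x‖⁻¹ • x) (punctured d : Set (Eu d)) := by
  intro x hx
  have hx' : x ≠ 0 := hx
  exact (((contDiffAt_norm ℝ hx').inv (norm_ne_zero_iff.2 hx')).smul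
    contDiffAt_id).contDiffWithinAt

theorem mapsTo_normalize (d : ℕ) :
    Set.MapsTo (fun x : Eu d => ‖x‖⁻¹ • x) (punctured d : Set (Eu d))
      (punctured d : Set (Eu d)) := fun x hx => by
  have hx' : x ≠ 0 := hx
  exact smul_ne_zero (inv_ne_zero (norm_ne_zero_iff.2 hx')) hx'

theorem contDiffOn_normPow (d : ℕ) (α : ℝ) :
    ContDiffOn ℝ ∞ (fun x : Eu d => ((‖x‖ ^ α : ℝ) : ℂ)) (punctured d : Set (Eu d)) := by
  intro x hx
  have hx' : x ≠ 0 := hx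
  exact (Complex.ofRealCLM.contDiff.contDiffAt.comp x
    ((contDiffAt_norm ℝ hx').rpow_const_of_ne (norm_ne_zero_iff.2 hx'))).contDiffWithinAt

/-- `u(x/|x|) ∈ 𝒢(ℝ^d ∖ {0})`. -/
def G.radialProj {d : ℕ} (u : G (punctured d)) : G (punctured d) :=
  u.comp (fun x => ‖x‖⁻¹ • x) (contDiffOn_normalize d) (mapsTo_normalize d)

/-- `|x|^α ∈ 𝒢(ℝ^d ∖ {0})`. -/
def normPow (d : ℕ) (α : ℝ) : G (punctured d) :=
  ofSmooth (punctured d) (fun x => ((‖x‖ ^ α : ℝ) : ℂ)) (contDiffOn_normPow d α)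

end Colombeau

end

/-!
Baire's theorem, applied to the scaling parameter `s = log λ`, upgrades the hypothesis
`u(λx) = λ^α u(x)` for each single `λ` to one that is uniform for `λ` near some `λ₀`; the cocycle
identity of the defect `u(λx) - λ^α u(x)` moves this neighbourhood to any other `λ`. The defect is
therefore negligible uniformly for `λ` in compact sets, and one may insert `λ = |x|` at the point
`x/|x|` to get `u(x) = |x|^α u(x/|x|)`. A Landau-type interpolation inequality shows that for a
moderate net negligibility has to be checked on the values only, not on the derivatives.

For `u` on the whole space let `h = |x|^α u(x/|x|)`, and let the smooth function `χ` be `0` near the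
origin and `1` near infinity. Then `u - χ (u - h)` represents the same generalized function as `u`,
and it is tempered since outside a ball it equals `h`, whose derivatives are homogeneous.
-/

namespace Colombeau

open Asymptotics

section UniformBigO

variable {X ι E F : Type*} [TopologicalSpace X] [SeminormedAddCommGroup E]
  [SeminormedAddCommGroup F] {l : Filter ι}

theorem exists_isBigO_nhds_prod [BaireSpace X] [Nonempty X] [l.IsCountablyGenerated]
    {f : X → ι → E} {g : ι → F} (hf : ∀ᶠ i in l, Continuous fun t => f t i)
    (hfg : ∀ t, f t =O[l] g) :
    ∃ t, (fun p : X × ι => f p.1 p.2) =O[𝓝 t ×ˢ l] fun p => g p.2 := by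
  obtain ⟨s, hs⟩ := l.exists_antitone_basis
  let A : ℕ → Set X := fun n =>
    {t | ∀ i ∈ s n, (Continuous fun t => f t i) → ‖f t i‖ ≤ n * ‖g i‖}
  have hA : ∀ n, IsClosed (A n) := fun n => by
    simp only [A, Set.ofPred_forall]
    exact isClosed_iInter fun i => isClosed_iInter fun _ => isClosed_iInter fun hi =>
      isClosed_le hi.norm continuous_const
  have hA_cover : ⋃ n, A n = Set.univ := by
    refine Set.eq_univ_of_forall fun t => Set.mem_iUnion.2 ?_
    obtain ⟨C, hC⟩ := (hfg t).bound
    obtain ⟨m, hm⟩ := hs.mem_iff.1 hC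
    obtain ⟨k, hk⟩ := exists_nat_ge C
    refine ⟨max m k, fun i hi _ => (hm (hs.antitone (le_max_left m k) hi)).trans ?_⟩
    have hCk : C ≤ (max m k : ℕ) := hk.trans (mod_cast le_max_right m k)
    gcongr
  obtain ⟨n, t, ht⟩ := nonempty_interior_of_iUnion_of_closed hA hA_cover
  refine ⟨t, IsBigO.of_bound n ?_⟩
  filter_upwards [prod_mem_prod (mem_interior_iff_mem_nhds.1 ht) (inter_mem (hs.mem n) hf)]
    with p ⟨hpA, hps, hpf⟩ using hpA _ hps hpf

theorem isBigO_principal_prod_of_isCompact {T : Set X}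
    (hT : IsCompact T) {f : X × ι → E} {g : X × ι → F}
    (h : ∀ t ∈ T, f =O[𝓝 t ×ˢ l] g) : f =O[𝓟 T ×ˢ l] g := by
  refine hT.induction_on (p := fun T => f =O[𝓟 T ×ˢ l] g) (by simp) ?_ ?_ fun t ht => ?_
  · exact fun _ _ hst hg => hg.mono (prod_mono_left _ (principal_mono.2 hst))
  · exact fun _ _ hs ht => by simpa only [← sup_principal, sup_prod] using hs.sup ht
  · obtain ⟨C, hC⟩ := (h t ht).bound
    obtain ⟨V, hV, W, hW, hVW⟩ := eventually_prod_iff.1 hC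
    exact ⟨{s | V s}, mem_nhdsWithin_of_mem_nhds hV,
      .of_bound C (eventually_prod_iff.2 ⟨V, mem_principal_self _, W, hW, hVW⟩)⟩

end UniformBigO

section Derivatives

variable {E F : Type*} [NormedAddCommGroup E] [NormedSpace ℝ E] [NormedAddCommGroup F]
  [NormedSpace ℝ F]

theorem norm_hasFDerivAt_le_of_closedBall {f : E → F} {f' : E → E →L[ℝ] F} {x : E} {h A K : ℝ}
    (hh : 0 < h) (hf : ∀ y ∈ Metric.closedBall x h, HasFDerivAt f (f' y) y)
    (hA : ∀ y ∈ Metric.closedBall x h, ‖f y‖ ≤ A)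
    (hK : ∀ y ∈ Metric.closedBall x h, ‖f' y - f' x‖ ≤ K) : ‖f' x‖ ≤ 2 * A / h + K := by
  have hx : x ∈ Metric.closedBall x h := Metric.mem_closedBall_self hh.le
  have hA_nonneg : 0 ≤ A := (norm_nonneg _).trans (hA x hx)
  have hK_nonneg : 0 ≤ K := (norm_nonneg _).trans (hK x hx)
  refine ContinuousLinearMap.opNorm_le_of_unit_norm (by positivity) fun v hv => ?_
  have hxv : x + h • v ∈ Metric.closedBall x h := by simp [norm_smul, hv, abs_of_pos hh]
  have hmean : ‖f (x + h • v) - f x - f' x (h • v)‖ ≤ K * h := by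
    simpa [norm_smul, hv, abs_of_pos hh] using
      (convex_closedBall x h).norm_image_sub_le_of_norm_hasFDerivWithin_le'
        (fun y hy => (hf y hy).hasFDerivWithinAt) hK hx hxv
  have hscaled : h * ‖f' x v‖ ≤ 2 * A + K * h := by
    calc h * ‖f' x v‖ = ‖f (x + h • v) - f x - (f (x + h • v) - f x - f' x (h • v))‖ := by
          rw [sub_sub_cancel, map_smul, norm_smul, Real.norm_of_nonneg hh.le]
      _ ≤ ‖f (x + h • v)‖ + ‖f x‖ + K * h :=
          (norm_sub_le _ _).trans (add_le_add (norm_sub_le _ _) hmean)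
      _ ≤ A + A + K * h := by gcongr <;> exact hA _ ‹_›
      _ = 2 * A + K * h := by ring
  calc ‖f' x v‖ ≤ (2 * A + K * h) / h := (le_div_iff₀' hh).2 hscaled
    _ = 2 * A / h + K := by field_simp

theorem norm_fderivWithin_iteratedFDerivWithin_sub (f : E → F) (s : Set E) (n : ℕ) (x y : E) :
    ‖fderivWithin ℝ (iteratedFDerivWithin ℝ n f s) s y -
        fderivWithin ℝ (iteratedFDerivWithin ℝ n f s) s x‖ =
      ‖iteratedFDerivWithin ℝ (n + 1) f s y - iteratedFDerivWithin ℝ (n + 1) f s x‖ := by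
  simp only [← dist_eq_norm, iteratedFDerivWithin_succ_eq_comp_left, Function.comp_apply,
    LinearIsometryEquiv.dist_map]
  rw [dist_eq_norm]

theorem norm_iteratedFDerivWithin_succ_le_of_closedBall {s : Set E} (hs : IsOpen s) {f : E → F}
    {n : ℕ} (hf : ContDiffOn ℝ (n + 2 : ℕ) f s) {x : E} {h A B : ℝ} (hh : 0 < h)
    (hball : Metric.closedBall x h ⊆ s)
    (hA : ∀ y ∈ Metric.closedBall x h, ‖iteratedFDerivWithin ℝ n f s y‖ ≤ A)
    (hB : ∀ y ∈ Metric.closedBall x h, ‖iteratedFDerivWithin ℝ (n + 2) f s y‖ ≤ B) :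
    ‖iteratedFDerivWithin ℝ (n + 1) f s x‖ ≤ 2 * A / h + B * h := by
  have hx : x ∈ Metric.closedBall x h := Metric.mem_closedBall_self hh.le
  have hB_nonneg : 0 ≤ B := (norm_nonneg _).trans (hB x hx)
  have hderiv : ∀ k < n + 2, ∀ y ∈ Metric.closedBall x h,
      HasFDerivAt (iteratedFDerivWithin ℝ k f s)
        (fderivWithin ℝ (iteratedFDerivWithin ℝ k f s) s y) y := fun k hk y hy =>
    (hf.differentiableOn_iteratedFDerivWithin (mod_cast hk) hs.uniqueDiffOn y
      (hball hy)).hasFDerivWithinAt.hasFDerivAt (hs.mem_nhds (hball hy))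
  rw [← norm_fderivWithin_iteratedFDerivWithin]
  refine norm_hasFDerivAt_le_of_closedBall hh (hderiv n (by omega)) hA fun y hy => ?_
  rw [norm_fderivWithin_iteratedFDerivWithin_sub]
  calc ‖iteratedFDerivWithin ℝ (n + 1) f s y - iteratedFDerivWithin ℝ (n + 1) f s x‖
      ≤ B * ‖y - x‖ := (convex_closedBall x h).norm_image_sub_le_of_norm_hasFDerivWithin_le
        (fun z hz => (hderiv (n + 1) (by omega) z hz).hasFDerivWithinAt)
        (fun z hz => (norm_fderivWithin_iteratedFDerivWithin ..).trans_le (hB z hz)) hx hy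
    _ ≤ B * h := by gcongr; exact mem_closedBall_iff_norm.1 hy

theorem norm_iteratedFDeriv_smul_of_map_smul {f : E → F} {c a : ℝ} (hc : c ≠ 0)
    (hf : ∀ y, f (c • y) = a • f y) {n : ℕ} {x : E} (hfx : ContDiffAt ℝ n f x) :
    |c| ^ n * ‖iteratedFDeriv ℝ n f (c • x)‖ = |a| * ‖iteratedFDeriv ℝ n f x‖ := by
  let g : E ≃L[ℝ] E := ContinuousLinearEquiv.smulLeft (Units.mk0 c hc)
  have hscaling : iteratedFDeriv ℝ n (f ∘ g) x = c ^ n • iteratedFDeriv ℝ n f (c • x) := by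
    have hcomp := g.iteratedFDerivWithin_comp_right f uniqueDiffOn_univ (x := x) trivial n
    simp only [Set.preimage_univ, iteratedFDerivWithin_univ] at hcomp
    ext v
    rw [hcomp]
    exact (iteratedFDeriv ℝ n f (c • x)).map_smul_univ (fun _ => c) v |>.trans (by simp)
  have hhom : iteratedFDeriv ℝ n (f ∘ g) x = a • iteratedFDeriv ℝ n f x := by
    rw [← iteratedFDeriv_const_smul_apply hfx]
    exact congrArg (iteratedFDeriv ℝ n · x) (funext hf)
  simpa [norm_smul] using congrArg norm (hscaling.symm.trans hhom)

end Derivatives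

variable {d n : ℕ} {Ω Ω' : Opens (Eu d)} {S S' : Set (Eu d)} {ρ : Idx → Eu d → ℝ} {u v : Net d}
  {α : ℝ}

section Nets

theorem hasBound_iff_isBigO (hρ : ∀ ε, ∀ x ∈ S, 0 ≤ ρ ε x) :
    HasBound Ω S n ρ u ↔
      (fun p : Idx × Eu d => iteratedFDerivWithin ℝ n (u p.1) (Ω : Set (Eu d)) p.2)
        =O[toZero ×ˢ 𝓟 S] fun p => ρ p.1 p.2 := by
  simp only [HasBound, isBigO_iff, eventually_prod_principal_iff]
  refine exists_congr fun C => eventually_congr (.of_forall fun ε => forall₂_congr fun x hx => ?_)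
  rw [Real.norm_of_nonneg (hρ ε x hx)]

theorem hasBound_zero_iff_isBigO (hρ : ∀ ε, ∀ x ∈ S, 0 ≤ ρ ε x) :
    HasBound Ω S 0 ρ u ↔
      (fun p : Idx × Eu d => u p.1 p.2) =O[toZero ×ˢ 𝓟 S] fun p => ρ p.1 p.2 := by
  rw [hasBound_iff_isBigO hρ, ← isBigO_norm_left]
  simp only [norm_iteratedFDerivWithin_zero, isBigO_norm_left]

theorem HasBound.mono_set (h : HasBound Ω S n ρ u) (hS : S' ⊆ S) : HasBound Ω S' n ρ u :=
  h.imp fun _ hC => hC.mono fun _ hε x hx => hε x (hS hx)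

theorem HasBound.union (hρ : ∀ ε, ∀ x ∈ S ∪ S', 0 ≤ ρ ε x) (h : HasBound Ω S n ρ u)
    (h' : HasBound Ω S' n ρ u) : HasBound Ω (S ∪ S') n ρ u := by
  rw [hasBound_iff_isBigO fun ε x hx => hρ ε x (.inl hx)] at h
  rw [hasBound_iff_isBigO fun ε x hx => hρ ε x (.inr hx)] at h'
  rw [hasBound_iff_isBigO hρ, ← sup_principal, prod_sup]
  exact h.sup h'

theorem HasBound.congr (h : HasBound Ω S n ρ u) (hS : S ⊆ Ω) (hS' : S ⊆ Ω')
    (huv : ∀ ε, ∀ x ∈ S, u ε =ᶠ[𝓝 x] v ε) : HasBound Ω' S n ρ v := by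
  obtain ⟨C, hC⟩ := h
  refine ⟨C, hC.mono fun ε hε x hx => ?_⟩
  rw [iteratedFDerivWithin_of_isOpen n Ω'.isOpen (hS' hx),
    ← ((huv ε x hx).iteratedFDeriv ℝ n).eq_of_nhds,
    ← iteratedFDerivWithin_of_isOpen n Ω.isOpen (hS hx)]
  exact hε x hx

theorem IsModerate.restrict (hu : IsModerate Ω u) (h : Ω' ≤ Ω) : IsModerate Ω' u :=
  hu.comp contDiffOn_id h

theorem IsNegligible.restrict (hu : IsNegligible Ω u) (h : Ω' ≤ Ω) : IsNegligible Ω' u :=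
  hu.comp contDiffOn_id h

theorem IsNegligible.isModerate (hu : IsNegligible Ω u) : IsModerate Ω u :=
  ⟨hu.1, fun S hS hSΩ n => ⟨0, by simpa using hu.2 S hS hSΩ n 0⟩⟩

theorem IsModerate.sub (hu : IsModerate Ω u) (hv : IsModerate Ω v) : IsModerate Ω (u - v) :=
  (moderate Ω).sub_mem hu hv

theorem IsNegligible.congr (hu : IsNegligible Ω u) (huv : ∀ ε, Set.EqOn (u ε) (v ε) Ω) :
    IsNegligible Ω v :=
  ⟨fun ε => (hu.1 ε).congr fun _ hx => (huv ε hx).symm, fun S hS hSΩ n m =>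
    (hu.2 S hS hSΩ n m).congr hSΩ hSΩ fun ε _ hx =>
      (huv ε).eventuallyEq_of_mem (Ω.isOpen.mem_nhds (hSΩ hx))⟩

theorem IsNegligible.sup (hu : IsNegligible Ω u) (hu' : IsNegligible Ω' u) :
    IsNegligible (Ω ⊔ Ω') u := by
  refine ⟨fun ε => ?_, fun S hS hSΩ n m => ?_⟩
  · rw [Opens.coe_sup]
    exact (hu.1 ε).union_of_isOpen (hu'.1 ε) Ω.isOpen Ω'.isOpen
  · rw [Opens.coe_sup] at hSΩ
    obtain ⟨S₁, S₂, hS₁, hS₂, hSΩ₁, hSΩ₂, rfl⟩ :=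
      hS.binary_compact_cover Ω.isOpen Ω'.isOpen hSΩ
    refine HasBound.union (fun ε _ _ => pow_nonneg ε.2.1.le m)
      ((hu.2 S₁ hS₁ hSΩ₁ n m).congr hSΩ₁ ?_ fun _ _ _ => .rfl)
      ((hu'.2 S₂ hS₂ hSΩ₂ n m).congr hSΩ₂ ?_ fun _ _ _ => .rfl)
    · exact hSΩ₁.trans (SetLike.coe_subset_coe.2 le_sup_left)
    · exact hSΩ₂.trans (SetLike.coe_subset_coe.2 le_sup_right)

theorem IsModerate.isNegligible_of_zero (hu : IsModerate Ω u)
    (h : ∀ S : Set (Eu d), IsCompact S → S ⊆ Ω → ∀ m : ℕ,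
      HasBound Ω S 0 (fun ε _ => (ε : ℝ) ^ m) u) : IsNegligible Ω u := by
  refine ⟨hu.1, fun S hS hSΩ n => ?_⟩
  induction n generalizing S with
  | zero => exact h S hS hSΩ
  | succ n ih =>
    intro m
    obtain ⟨δ, hδ, hδΩ⟩ := hS.exists_cthickening_subset_open Ω.isOpen hSΩ
    obtain ⟨N, B, hB⟩ := hu.2 _ hS.cthickening hδΩ (n + 2)
    obtain ⟨A, hA⟩ := ih _ hS.cthickening hδΩ (N + 2 * m)
    refine ⟨2 * A / δ + B * δ, ?_⟩
    filter_upwards [hA, hB] with ε hAε hBε x hx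
    have hε := ε.2.1
    have hball : Metric.closedBall x (δ * (ε : ℝ) ^ (N + m)) ⊆ Metric.cthickening δ S :=
      (Metric.closedBall_subset_closedBall (mul_le_of_le_one_right hδ.le
        (pow_le_one₀ hε.le ε.2.2))).trans (Metric.closedBall_subset_cthickening hx δ)
    -- The radius `δ ε^(N + m)` balances `A ε^(N + 2m) / radius` against `B ε^(-N) * radius`.
    refine (norm_iteratedFDerivWithin_succ_le_of_closedBall Ω.isOpen
      (contDiffOn_infty.1 (hu.1 ε) (n + 2)) (by positivity) (hball.trans hδΩ)
      (fun y hy => hAε y (hball hy)) (fun y hy => hBε y (hball hy))).trans_eq ?_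
    simp only [pow_add, two_mul]
    field_simp

theorem IsModerate.isTemperedModerate_of_lt_norm (hu : IsModerate (⊤ : Opens (Eu d)) u) (R : ℝ)
    (h : ∀ n : ℕ, ∃ N : ℕ, HasBound (⊤ : Opens (Eu d)) {x | R < ‖x‖} n
      (fun ε x => ((ε : ℝ) ^ N)⁻¹ * (1 + ‖x‖) ^ N) u) :
    IsTemperedModerate (⊤ : Opens (Eu d)) u := by
  refine ⟨hu.1, fun n => ?_⟩
  obtain ⟨N, hN⟩ := h n
  obtain ⟨M, hM⟩ := hu.2 (Metric.closedBall 0 R) (isCompact_closedBall 0 R) (fun _ _ => trivial) n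
  have hpos : ∀ (k : ℕ) (ε : Idx) (x : Eu d), 0 ≤ ((ε : ℝ) ^ k)⁻¹ * (1 + ‖x‖) ^ k := fun k ε x => by
    have := ε.2.1
    positivity
  have hone : ∀ x : Eu d, 1 ≤ 1 + ‖x‖ := fun x => le_add_of_nonneg_right (norm_nonneg x)
  refine ⟨N + M, (HasBound.union (fun ε x _ => hpos _ ε x) (hN.mono (fun ε x _ => hpos _ ε x) ?_)
    (hM.mono ?_ ?_)).mono_set fun x _ => ?_⟩
  · intro ε x _
    exact mul_le_mul (idx_inv_pow_le ε (by omega)) (pow_le_pow_right₀ (hone x) (by omega))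
      (by positivity) (inv_nonneg.2 (pow_nonneg ε.2.1.le _))
  · exact fun ε _ _ => inv_nonneg.2 (pow_nonneg ε.2.1.le _)
  · exact fun ε x _ => (idx_inv_pow_le ε (by omega)).trans
      (le_mul_of_one_le_right (inv_nonneg.2 (pow_nonneg ε.2.1.le _)) (one_le_pow₀ (hone x)))
  · simpa using lt_or_ge R ‖x‖

end Nets

section Homogeneity

/-- The defect of homogeneity `u_ε(c x) - c^α u_ε(x)`, as a net. -/
noncomputable def homDefect {d : ℕ} (α c : ℝ) (u : Net d) : Net d :=
  fun ε x => u ε (c • x) - ((c ^ α : ℝ) : ℂ) * u ε x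

/-- The net `u_ε(x/|x|) |x|^α`, the extension of `u` from the unit sphere that is homogeneous of
degree `α`. The value at the origin is irrelevant. -/
noncomputable def homExtension {d : ℕ} (α : ℝ) (u : Net d) : Net d :=
  fun ε x => u ε (‖x‖⁻¹ • x) * ((‖x‖ ^ α : ℝ) : ℂ)

theorem homDefect_mul {a b : ℝ} (ha : 0 ≤ a) (hb : 0 ≤ b) (ε : Idx) (x : Eu d) :
    homDefect α (a * b) u ε x =
      homDefect α a u ε (b • x) + ((a ^ α : ℝ) : ℂ) * homDefect α b u ε x := by
  simp only [homDefect, Real.mul_rpow ha hb, mul_smul, Complex.ofReal_mul]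
  ring

theorem continuous_homDefect_exp (hΩ : IsCone Ω) {ε : Idx} (hu : ContinuousOn (u ε) Ω) {x : Eu d}
    (hx : x ∈ Ω) : Continuous fun s : ℝ => homDefect α (Real.exp s) u ε x := by
  have hcomp : Continuous fun s : ℝ => u ε (Real.exp s • x) :=
    hu.comp_continuous (by fun_prop) fun s => hΩ _ (Real.exp_pos s) hx
  have hpow : Continuous fun s : ℝ => ((Real.exp s ^ α : ℝ) : ℂ) := by
    simp only [← Real.exp_mul]
    fun_prop
  exact hcomp.sub (hpow.mul continuous_const)

theorem isBigO_homDefect_exp_nhds (hΩ : IsCone Ω) (hu : ∀ ε, ContinuousOn (u ε) Ω) {r : Idx → ℝ}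
    (h : ∀ c : ℝ, 0 < c → ∀ L : Set (Eu d), IsCompact L → L ⊆ Ω →
      (fun p : Idx × Eu d => homDefect α c u p.1 p.2) =O[toZero ×ˢ 𝓟 L] fun p => r p.1)
    {L : Set (Eu d)} (hL : IsCompact L) (hLΩ : L ⊆ Ω) (t₀ : ℝ) :
    (fun p : ℝ × Idx × Eu d => homDefect α (Real.exp p.1) u p.2.1 p.2.2)
      =O[𝓝 t₀ ×ˢ toZero ×ˢ 𝓟 L] fun p => r p.2.1 := by
  have : toZero.IsCountablyGenerated := comap.isCountablyGenerated _ _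
  obtain ⟨t, ht⟩ := exists_isBigO_nhds_prod
    (f := fun (s : ℝ) (p : Idx × Eu d) => homDefect α (Real.exp s) u p.1 p.2)
    (eventually_prod_principal_iff.2 (.of_forall fun ε x hx =>
      continuous_homDefect_exp hΩ (hu ε) (hLΩ hx)))
    fun s => h (Real.exp s) (Real.exp_pos s) L hL hLΩ
  let L' : Set (Eu d) := (fun q : ℝ × Eu d => Real.exp q.1 • q.2) '' Set.Icc (t - 1) (t + 1) ×ˢ L
  have hL' : IsCompact L' := (isCompact_Icc.prod hL).image (by fun_prop)
  have hL'Ω : L' ⊆ Ω := by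
    rintro _ ⟨q, hq, rfl⟩
    exact hΩ _ (Real.exp_pos _) (hLΩ hq.2)
  have hshift : Tendsto (fun s : ℝ => s - (t₀ - t)) (𝓝 t₀) (𝓝 t) := by
    simpa using (continuous_sub_right (t₀ - t)).tendsto t₀
  have hscale : Tendsto (fun p : ℝ × Idx × Eu d => (p.2.1, Real.exp (p.1 - (t₀ - t)) • p.2.2))
      (𝓝 t₀ ×ˢ toZero ×ˢ 𝓟 L) (toZero ×ˢ 𝓟 L') := by
    refine (tendsto_fst.comp tendsto_snd).prodMk (tendsto_principal.2 ?_)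
    filter_upwards [prod_mem_prod
      (hshift (Icc_mem_nhds (sub_one_lt t) (lt_add_one t)))
      (prod_mem_prod univ_mem (mem_principal_self L))] with p hp
    exact ⟨(p.1 - (t₀ - t), p.2.2), ⟨hp.1, hp.2.2⟩, rfl⟩
  have hdecomp := ((h _ (Real.exp_pos (t₀ - t)) L' hL' hL'Ω).comp_tendsto hscale).add
    ((ht.comp_tendsto (hshift.prodMap tendsto_id)).const_mul_left
      ((Real.exp (t₀ - t) ^ α : ℝ) : ℂ))
  refine hdecomp.congr_left fun p => ?_
  simp only [Function.comp_apply, Prod.map_fst, Prod.map_snd, id_eq]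
  rw [← homDefect_mul (Real.exp_pos _).le (Real.exp_pos _).le, ← Real.exp_add, add_sub_cancel]

theorem sub_homExtension_apply (ε : Idx) (x : Eu d) :
    (u - homExtension α u) ε x = homDefect α ‖x‖ u ε (‖x‖⁻¹ • x) := by
  have hx : ‖x‖ • ‖x‖⁻¹ • x = x := by
    rcases eq_or_ne x 0 with rfl | hx
    · simp
    · exact smul_inv_smul₀ (norm_ne_zero_iff.2 hx) x
  simp only [Pi.sub_apply, homExtension, homDefect, hx, mul_comm]

theorem homDefect_homExtension {c : ℝ} (hc : 0 < c) : homDefect α c (homExtension α u) = 0 := by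
  ext ε x
  have hnorm : ‖c • x‖ = c * ‖x‖ := by rw [norm_smul, Real.norm_of_nonneg hc.le]
  have hproj : ‖c • x‖⁻¹ • c • x = ‖x‖⁻¹ • x := by
    rw [hnorm, smul_smul, mul_inv, mul_right_comm, inv_mul_cancel₀ hc.ne', one_mul]
  simp only [homDefect, homExtension, hproj]
  simp only [hnorm, Real.mul_rpow hc.le (norm_nonneg x),
    Complex.ofReal_mul, Pi.zero_apply]
  ring

theorem sphere_subset_punctured (d : ℕ) : Metric.sphere (0 : Eu d) 1 ⊆ punctured d :=
  fun _ hx => Metric.ne_of_mem_sphere hx one_ne_zero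

theorem inv_norm_smul_mem_sphere {x : Eu d} (hx : x ≠ 0) :
    ‖x‖⁻¹ • x ∈ Metric.sphere (0 : Eu d) 1 := by
  simpa using norm_smul_inv_norm (𝕜 := ℝ) hx

theorem IsModerate.homExtension (hu : IsModerate (punctured d) u) :
    IsModerate (punctured d) (homExtension α u) :=
  (hu.comp (contDiffOn_normalize d) (mapsTo_normalize d)).mul
    (isModerate_of_contDiffOn (contDiffOn_normPow d α))

theorem isBigO_sub_homExtension (hu : ∀ ε, ContinuousOn (u ε) (punctured d)) {r : Idx → ℝ}
    (h : ∀ c : ℝ, 0 < c → ∀ L : Set (Eu d), IsCompact L → L ⊆ punctured d →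
      (fun p : Idx × Eu d => homDefect α c u p.1 p.2) =O[toZero ×ˢ 𝓟 L] fun p => r p.1)
    (hS : IsCompact S) (hSΩ : S ⊆ punctured d) :
    (fun p : Idx × Eu d => (u - homExtension α u) p.1 p.2) =O[toZero ×ˢ 𝓟 S] fun p => r p.1 := by
  have hS_ne : ∀ x ∈ S, x ≠ 0 := fun x hx => hSΩ hx
  let T : Set ℝ := (fun x : Eu d => Real.log ‖x‖) '' S
  have hT : IsCompact T := hS.image_of_continuousOn
    (continuous_norm.continuousOn.log fun x hx => norm_ne_zero_iff.2 (hS_ne x hx))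
  have huniform := isBigO_principal_prod_of_isCompact hT fun t _ =>
    isBigO_homDefect_exp_nhds (isCone_punctured d) hu h (isCompact_sphere 0 1)
      (sphere_subset_punctured d) t
  have hS_mem : ∀ᶠ p in toZero ×ˢ 𝓟 S, p.2 ∈ S :=
    tendsto_snd.eventually (mem_principal_self S)
  have hpolar : Tendsto (fun p : Idx × Eu d => (Real.log ‖p.2‖, p.1, ‖p.2‖⁻¹ • p.2))
      (toZero ×ˢ 𝓟 S) (𝓟 T ×ˢ toZero ×ˢ 𝓟 (Metric.sphere 0 1)) :=
    (tendsto_principal.2 (hS_mem.mono fun p hp => Set.mem_image_of_mem _ hp)).prodMk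
      (tendsto_fst.prodMk (tendsto_principal.2
        (hS_mem.mono fun p hp => inv_norm_smul_mem_sphere (hS_ne p.2 hp))))
  refine (huniform.comp_tendsto hpolar).congr' (hS_mem.mono fun p hp => ?_) .rfl
  simp only [Function.comp_apply, sub_homExtension_apply,
    Real.exp_log (norm_pos_iff.2 (hS_ne p.2 hp))]

theorem isNegligible_sub_homExtension (hu : IsModerate (punctured d) u)
    (h : ∀ c : ℝ, 0 < c → IsNegligible (punctured d) (homDefect α c u)) :
    IsNegligible (punctured d) (u - homExtension α u) := by
  refine (hu.sub hu.homExtension).isNegligible_of_zero fun S hS hSΩ m => ?_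
  have hpow : ∀ ε : Idx, 0 ≤ (ε : ℝ) ^ m := fun ε => pow_nonneg ε.2.1.le m
  have hdefect : ∀ c : ℝ, 0 < c → ∀ L : Set (Eu d), IsCompact L → L ⊆ punctured d →
      (fun p : Idx × Eu d => homDefect α c u p.1 p.2) =O[toZero ×ˢ 𝓟 L]
        fun p => (p.1 : ℝ) ^ m := fun c hc L hL hLΩ =>
    (hasBound_zero_iff_isBigO fun ε _ _ => hpow ε).1 ((h c hc).2 L hL hLΩ 0 m)
  exact (hasBound_zero_iff_isBigO fun ε _ _ => hpow ε).2
    (isBigO_sub_homExtension (r := fun ε => (ε : ℝ) ^ m) (fun ε => (hu.1 ε).continuousOn)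
      hdefect hS hSΩ)

theorem norm_iteratedFDerivWithin_mul_of_homDefect_eq_zero (hu : IsSmoothNet (punctured d) u)
    (h : ∀ c : ℝ, 0 < c → homDefect α c u = 0) (n : ℕ) (ε : Idx) {x : Eu d} (hx : x ≠ 0) :
    ‖x‖ ^ n * ‖iteratedFDerivWithin ℝ n (u ε) (punctured d : Set (Eu d)) x‖ =
      ‖x‖ ^ α *
        ‖iteratedFDerivWithin ℝ n (u ε) (punctured d : Set (Eu d)) (‖x‖⁻¹ • x)‖ := by
  have hx_pos : 0 < ‖x‖ := norm_pos_iff.2 hx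
  have hy : ‖x‖⁻¹ • x ∈ punctured d := mapsTo_normalize d hx
  have hhom : ∀ y, u ε (‖x‖ • y) = (‖x‖ ^ α) • u ε y := fun y => by
    simpa [Complex.real_smul] using sub_eq_zero.1 (congrFun (congrFun (h ‖x‖ hx_pos) ε) y)
  have hsmooth : ContDiffAt ℝ n (u ε) (‖x‖⁻¹ • x) :=
    ((hu ε).contDiffAt ((punctured d).isOpen.mem_nhds hy)).of_le (mod_cast le_top)
  rw [iteratedFDerivWithin_of_isOpen n (punctured d).isOpen hx,
    iteratedFDerivWithin_of_isOpen n (punctured d).isOpen hy]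
  simpa only [smul_inv_smul₀ hx_pos.ne', abs_norm, abs_of_nonneg (Real.rpow_nonneg hx_pos.le α)]
    using norm_iteratedFDeriv_smul_of_map_smul hx_pos.ne' hhom hsmooth

theorem IsModerate.exists_hasBound_of_homDefect_eq_zero (hu : IsModerate (punctured d) u)
    (h : ∀ c : ℝ, 0 < c → homDefect α c u = 0) (n : ℕ) :
    ∃ N : ℕ, HasBound (punctured d) {x | 1 ≤ ‖x‖} n
      (fun ε x => ((ε : ℝ) ^ N)⁻¹ * (1 + ‖x‖) ^ N) u := by
  obtain ⟨N, C, hC⟩ := hu.2 _ (isCompact_sphere 0 1) (sphere_subset_punctured d) n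
  obtain ⟨M, hM⟩ := exists_nat_ge α
  refine ⟨N + M, |C|, hC.mono fun ε hε x (hx : 1 ≤ ‖x‖) => ?_⟩
  have hε_pos := ε.2.1
  have hx_ne : x ≠ 0 := norm_pos_iff.1 (zero_lt_one.trans_le hx)
  have hgrowth : ‖x‖ ^ α ≤ (1 + ‖x‖) ^ (N + M) := by
    calc ‖x‖ ^ α ≤ ‖x‖ ^ (M : ℝ) := Real.rpow_le_rpow_of_exponent_le hx hM
      _ = ‖x‖ ^ M := Real.rpow_natCast _ _
      _ ≤ (1 + ‖x‖) ^ M := by gcongr; linarith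
      _ ≤ (1 + ‖x‖) ^ (N + M) := pow_le_pow_right₀ (by linarith) (by omega)
  have hsphere : ‖iteratedFDerivWithin ℝ n (u ε) (punctured d : Set (Eu d)) (‖x‖⁻¹ • x)‖ ≤
      |C| * ((ε : ℝ) ^ (N + M))⁻¹ :=
    (hε _ (inv_norm_smul_mem_sphere hx_ne)).trans
      (mul_le_mul (le_abs_self C) (idx_inv_pow_le ε (by omega)) (by positivity) (abs_nonneg C))
  calc ‖iteratedFDerivWithin ℝ n (u ε) (punctured d : Set (Eu d)) x‖
      ≤ ‖x‖ ^ n * ‖iteratedFDerivWithin ℝ n (u ε) (punctured d : Set (Eu d)) x‖ :=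
        le_mul_of_one_le_left (norm_nonneg _) (one_le_pow₀ hx)
    _ = ‖x‖ ^ α *
          ‖iteratedFDerivWithin ℝ n (u ε) (punctured d : Set (Eu d)) (‖x‖⁻¹ • x)‖ :=
        norm_iteratedFDerivWithin_mul_of_homDefect_eq_zero hu.1 h n ε hx_ne
    _ ≤ (1 + ‖x‖) ^ (N + M) * (|C| * ((ε : ℝ) ^ (N + M))⁻¹) := by gcongr
    _ = |C| * (((ε : ℝ) ^ (N + M))⁻¹ * (1 + ‖x‖) ^ (N + M)) := by ring

end Homogeneity

section Cutoff

theorem exists_contDiff_eq_zero_of_norm_lt_eq_one_of_lt_norm (E : Type*) [NormedAddCommGroup E]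
    [NormedSpace ℝ E] [HasContDiffBump E] {r R : ℝ} (hr : 0 < r) (hrR : r < R) :
    ∃ χ : E → ℂ, ContDiff ℝ ∞ χ ∧ (∀ x, ‖x‖ < r → χ x = 0) ∧ ∀ x, R < ‖x‖ → χ x = 1 := by
  let b : ContDiffBump (0 : E) := ⟨r, R, hr, hrR⟩
  refine ⟨fun x => ((1 - b x : ℝ) : ℂ),
    Complex.ofRealCLM.contDiff.comp (contDiff_const.sub b.contDiff), fun x hx => ?_,
    fun x hx => ?_⟩
  · have hb : b x = 1 := b.one_of_mem_closedBall (by simpa [b] using hx.le)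
    simp [hb]
  · have hb : b x = 0 := b.zero_of_le_dist (by simpa [b] using hx.le)
    simp [hb]

theorem IsNegligible.cutoff_mul (hu : IsNegligible (punctured d) u) {χ : Eu d → ℂ}
    (hχ : ContDiffOn ℝ ∞ χ (punctured d)) {R : ℝ} (hR : 0 < R) (hχR : ∀ x, ‖x‖ < R → χ x = 0) :
    IsNegligible (⊤ : Opens (Eu d)) ((fun _ => χ) * u) := by
  let ball : Opens (Eu d) := ⟨Metric.ball 0 R, Metric.isOpen_ball⟩
  have hball : IsNegligible ball ((fun _ => χ) * u) :=
    isNegligible_zero.congr fun ε x hx => by simp [hχR x (mem_ball_zero_iff.1 hx)]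
  have hcover : punctured d ⊔ ball = ⊤ := by
    ext x
    rcases eq_or_ne x 0 with rfl | hx
    · simp [ball, hR]
    · simp [punctured, hx]
  exact hcover ▸ ((isModerate_of_contDiffOn hχ).mul_negligible hu).sup hball

end Cutoff

theorem exists_isTemperedModerate_isNegligible_sub (hu : IsModerate (⊤ : Opens (Eu d)) u)
    (h : ∀ c : ℝ, 0 < c → IsNegligible (⊤ : Opens (Eu d)) (homDefect α c u)) :
    ∃ v : Net d, IsTemperedModerate (⊤ : Opens (Eu d)) v ∧
      IsNegligible (⊤ : Opens (Eu d)) (v - u) := by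
  obtain ⟨χ, hχ, hχ_zero, hχ_one⟩ :=
    exists_contDiff_eq_zero_of_norm_lt_eq_one_of_lt_norm (Eu d) one_pos one_lt_two
  have hu₀ : IsModerate (punctured d) u := hu.restrict le_top
  have hneg : IsNegligible (⊤ : Opens (Eu d)) ((fun _ => -χ) * (u - homExtension α u)) :=
    (isNegligible_sub_homExtension hu₀ fun c hc => (h c hc).restrict le_top).cutoff_mul
      hχ.neg.contDiffOn one_pos fun x hx => by simp [hχ_zero x hx]
  refine ⟨u + (fun _ => -χ) * (u - homExtension α u), ?_, by rwa [add_sub_cancel_left]⟩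
  refine (hu.add hneg.isModerate).isTemperedModerate_of_lt_norm 2 fun n => ?_
  obtain ⟨N, hN⟩ := (hu₀.homExtension (α := α)).exists_hasBound_of_homDefect_eq_zero
    (fun _ => homDefect_homExtension) n
  have hsub : {x : Eu d | 2 < ‖x‖} ⊆ {x | 1 ≤ ‖x‖} := fun x (hx : 2 < ‖x‖) =>
    (one_lt_two.trans hx).le
  refine ⟨N, (hN.mono_set hsub).congr (fun x (hx : 2 < ‖x‖) => norm_pos_iff.1 (by linarith))
    (fun _ _ => trivial) fun ε x hx => ?_⟩
  filter_upwards [(isOpen_lt continuous_const continuous_norm).mem_nhds hx] with y hy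
  simp [hχ_one y hy]

theorem G.isHomogeneous_mk_iff (hΩ : IsCone Ω) (w : moderate Ω) :
    G.IsHomogeneous hΩ (Ideal.Quotient.mk (negligible Ω) w) α ↔
      ∀ c : ℝ, 0 < c → IsNegligible Ω (homDefect α c (w : Net d)) :=
  forall₂_congr fun _ _ => Ideal.Quotient.eq

theorem G.IsHomogeneous.eq_radialProj_mul_normPow {u : G (punctured d)}
    (hu : G.IsHomogeneous (isCone_punctured d) u α) : u = G.radialProj u * normPow d α := by
  obtain ⟨w, rfl⟩ := Ideal.Quotient.mk_surjective u
  exact Ideal.Quotient.eq.2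
    (isNegligible_sub_homExtension w.2 ((G.isHomogeneous_mk_iff _ w).1 hu))

theorem G.IsHomogeneous.exists_K_eq {u : G (⊤ : Opens (Eu d))}
    (hu : G.IsHomogeneous (isCone_univ d) u α) :
    ∃ v : Gτ (⊤ : Opens (Eu d)), K (⊤ : Opens (Eu d)) v = u := by
  obtain ⟨w, rfl⟩ := Ideal.Quotient.mk_surjective u
  obtain ⟨v, hv, hvw⟩ :=
    exists_isTemperedModerate_isNegligible_sub w.2 ((G.isHomogeneous_mk_iff _ w).1 hu)
  exact ⟨Ideal.Quotient.mk _ ⟨v, hv⟩, Ideal.Quotient.eq.2 hvw⟩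

end Colombeau

theorem mainTheorem3 (d : ℕ) (hd : 1 ≤ d) (α : ℝ) :
    (∀ u : Colombeau.G (Colombeau.punctured d),
      Colombeau.G.IsHomogeneous (Colombeau.isCone_punctured d) u α →
        u = Colombeau.G.radialProj u * Colombeau.normPow d α) ∧
    (∀ u : Colombeau.G (⊤ : TopologicalSpace.Opens (Colombeau.Eu d)),
      Colombeau.G.IsHomogeneous (Colombeau.isCone_univ d) u α →
        ∃ v : Colombeau.Gτ (⊤ : TopologicalSpace.Opens (Colombeau.Eu d)),
          Colombeau.K (⊤ : TopologicalSpace.Opens (Colombeau.Eu d)) v = u) :=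
  ⟨fun _ hu => hu.eq_radialProj_mul_normPow, fun _ hu => hu.exists_K_eq⟩
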